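/- For an algebraic number $\alpha \in \mathbb{C}$, let $M_\alpha$ be the additive monoid $\mathbb{N}_0[\alpha] = \{p(\alpha) : p(x) \in \mathbb{N}_0[x]\}$. An atom of $M_\alpha$ is a non-invertible element $a \in M_\alpha$ such that whenever $a = u + v$ with $u, v \in M_\alpha$, one of $u, v$ is invertible in $M_\alpha$. An atom $a$ is a strong atom if, for every positive integer $k$, the only way to write $ka$ as a finite sum of atoms of $M_\alpha$ (up to order) is as the sum of $k$ copies of $a$. A pair $(m, n) \in (\mathbb{N}_0 \cup \{\infty\})^2$ is called realizable if there is an algebraic number $\alpha \in \mathbb{C}$ such that $M_\alpha$ has exactly $m$ strong atoms and exactly $n$ atoms. Then, for every $n \in \mathbb{N}_0$, the pair $(n, n+1)$ is realizable if and only if $n \ge 4$. -/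

import Mathlib

/-- The cyclic semidomain `ℕ₀[α] = {p(α) : p ∈ ℕ₀[x]}`, as a subsemiring of `ℂ`. -/
noncomputable def cyclicSemidomain (α : ℂ) : Subsemiring ℂ :=
  (Polynomial.eval₂RingHom (Nat.castRingHom ℂ) α).rangeS

/-- The underlying additive monoid `M_α` of `ℕ₀[α]`. -/
noncomputable def cyclicMonoid (α : ℂ) : AddSubmonoid ℂ :=
  (cyclicSemidomain α).toAddSubmonoid

/-- The atoms of an additive commutative monoid: the non-invertible elements `a` such that
`a = u + v` forces `u` or `v` to be invertible. -/
def atomSet (M : Type*) [AddCommMonoid M] : Set M :=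
  {a | AddIrreducible a}

/-- The strong atoms: the atoms `a` such that for every positive integer `n`, the only
decomposition of `n • a` as a finite (unordered) sum of atoms is the one with `n` copies of `a`. -/
def strongAtomSet (M : Type*) [AddCommMonoid M] : Set M :=
  {a | a ∈ atomSet M ∧ ∀ n : ℕ, 1 ≤ n → ∀ s : Multiset M,
    (∀ b ∈ s, b ∈ atomSet M) → s.sum = n • a → s = Multiset.replicate n a}

/-- The realization function `α ↦ (|S(M_α)|, |A(M_α)|)`, with values in `(ℕ₀ ∪ {∞})²`. -/
noncomputable def realizationFunction (α : ℂ) : ℕ∞ × ℕ∞ :=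
  ((strongAtomSet (cyclicMonoid α)).encard, (atomSet (cyclicMonoid α)).encard)

/-- The pair `(m, n)` is realizable if it is a value of the realization function at some
algebraic number. -/
def IsRealizable (m n : ℕ∞) : Prop :=
  ∃ α : ℂ, IsAlgebraic ℚ α ∧ realizationFunction α = (m, n)

/-!
Unless `α = 0`, the monoid `M_α` is a group, and so has no atoms, as soon as `α` satisfies a
nontrivial relation with nonnegative coefficients (`noNatRelation_of_atomSet_nonempty`). Otherwise
`α` has a positive real conjugate `r`: if a rational polynomial has no positive root, its product
with a high power of `1 + x` has coefficients all of one sign, which would be such a relation for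
`α` (`NoNatRelation.exists_pos_root`). Since `p(α) = q(α)` implies `p(r) = q(r)`, the order of the
real numbers controls the representations in `ℕ₀[α]`. For `α = 0` and `α = 1` the
monoid is `ℕ₀`; in the remaining cases the atoms are the powers of `α` with a unique representation,
and they form an initial segment
`1, α, …, α ^ (N - 1)`. If `N` is finite, then `α ^ N = p(α)` with `p ∈ ℕ₀[x]` of degree less than
`N`. An atom fails to be strong precisely when `α` satisfies a nontrivial integer relation of degree
less than `N` with a single negative coefficient, at the exponent of that atom
(`powElem_mem_strongAtomSet_iff`).

Realizing `(n, n + 1)` with `n ≤ 3` requires a nontrivial relation of this kind with `N = n + 1 ≤ 4`.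
A single atom is always strong, so `N ≥ 2`. The minimal polynomial `m` of `α` divides both that
relation and `x ^ N - p`, so its degree `d` is less than `N`. Inspecting the signs of the
coefficients of `x ^ N - p = m g` excludes `d = 1` and `d = 2`, and for `d = 3`, `N = 4` it forces
the signs of `m` to alternate; the relation, then a constant multiple of `m`, has two negative
coefficients (`eq_zero_of_coeff_nonneg`).

For `n = k + 4` a root `α > 1` of `m = x^(k+3) - 8 x^(k+2) + 12 x^(k+1) - 20 x^k - 2` realizes the
pair. The polynomial is irreducible by Eisenstein's criterion, so the relations of degree at most
`k + 4` are the products `(u x + v) m`, and five of their coefficients suffice to show that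
`1, …, α ^ (k + 4)` are atoms and that all of them but the last are strong. The products
`(2 x + 3) m` and `(x + 1)² m` each have only one positive coefficient, the leading one, so
`α ^ (k + 4)` is not strong and `α ^ (k + 5)` is not an atom.
-/

open Polynomial

/-! ### Atoms of `ℕ₀[α]` -/

theorem mem_cyclicMonoid {α z : ℂ} : z ∈ cyclicMonoid α ↔ ∃ p : ℕ[X], aeval α p = z :=
  Iff.rfl

/-- `ℕ₀[α]` satisfies no nontrivial relation `p(α) = 0` with `p ∈ ℕ₀[x]`. For `α ≠ 0` this says
that the additive monoid `M_α` is reduced. -/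
def NoNatRelation (α : ℂ) : Prop :=
  ∀ p : ℕ[X], aeval α p = 0 → p = 0

/-- The power `α ^ k` is represented by no polynomial of `ℕ₀[x]` other than `x ^ k`. -/
def HasUniqueRep (α : ℂ) (k : ℕ) : Prop :=
  ∀ p : ℕ[X], aeval α p = α ^ k → p = X ^ k

theorem exists_eq_X_pow_add {p : ℕ[X]} {i : ℕ} (h : p.coeff i ≠ 0) : ∃ q, p = X ^ i + q := by
  refine ⟨p.erase i + monomial i (p.coeff i - 1), ?_⟩
  ext j
  by_cases hj : j = i
  · subst hj
    simp [coeff_X_pow]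
    omega
  · simp [coeff_X_pow, coeff_monomial, hj, Ne.symm hj]

/-- A relation with nonnegative coefficients makes `-1` an element of `ℕ₀[α]`, so that `M_α` is a
group and has no atoms. -/
theorem noNatRelation_of_atomSet_nonempty {α : ℂ} (hα : α ≠ 0)
    (h : (atomSet (cyclicMonoid α)).Nonempty) : NoNatRelation α := by
  intro p hp
  by_contra hp0
  obtain ⟨a, ha⟩ := h
  have hneg : (-1 : ℂ) ∈ cyclicSemidomain α := by
    obtain ⟨q, hq⟩ : X ^ p.natTrailingDegree ∣ p :=
      X_pow_dvd_iff.2 fun d hd => coeff_eq_zero_of_lt_natTrailingDegree hd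
    have hq0 : q.coeff 0 ≠ 0 := by
      have h1 : p.coeff p.natTrailingDegree ≠ 0 := by
        simpa [trailingCoeff] using (trailingCoeff_nonzero_iff_nonzero.2 hp0)
      have h2 : (X ^ p.natTrailingDegree * q).coeff (0 + p.natTrailingDegree) = q.coeff 0 :=
        coeff_X_pow_mul q _ 0
      rw [← hq, zero_add] at h2
      rwa [← h2]
    obtain ⟨q', rfl⟩ := exists_eq_X_pow_add hq0
    have h3 : aeval α q' = -1 := by
      rw [hq, map_mul, map_pow, aeval_X] at hp
      have := (mul_eq_zero.1 hp).resolve_left (pow_ne_zero _ hα)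
      simp at this
      linear_combination this
    exact ⟨q', h3⟩
  apply ha.not_isAddUnit
  refine isAddUnit_iff_exists_neg.2 ⟨⟨-1 * (a : ℂ), ?_⟩, ?_⟩
  · exact (cyclicSemidomain α).mul_mem hneg a.2
  · ext; simp

theorem NoNatRelation.eq_zero_of_isAddUnit {α : ℂ} (hred : NoNatRelation α) {p : ℕ[X]}
    {z : cyclicMonoid α} (hz : (z : ℂ) = aeval α p) (hu : IsAddUnit z) : p = 0 := by
  obtain ⟨w, hw⟩ := isAddUnit_iff_exists_neg.1 hu
  obtain ⟨q, hq⟩ := mem_cyclicMonoid.1 w.2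
  have h1 : aeval α (p + q) = 0 := by
    rw [map_add, hq, ← hz, ← AddSubmonoid.coe_add, hw, AddSubmonoid.coe_zero]
  have h2 := hred _ h1
  ext i
  have := congrArg (fun r => r.coeff i) h2
  simp at this
  simp [this.1]

theorem NoNatRelation.ne_zero {α : ℂ} (hred : NoNatRelation α) : α ≠ 0 := fun h =>
  X_ne_zero (hred X (by simpa using h))

/-- An atom of `M_α` is a power of `α`, by whatever polynomial it is represented. -/
theorem NoNatRelation.eq_X_pow_of_mem_atomSet {α : ℂ} (hred : NoNatRelation α)
    {z : cyclicMonoid α} (hz : z ∈ atomSet (cyclicMonoid α)) {p : ℕ[X]}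
    (hp : aeval α p = (z : ℂ)) : ∃ i, p = X ^ i := by
  have hp0 : p ≠ 0 := by
    rintro rfl
    apply hz.not_isAddUnit
    have : z = 0 := by ext; simpa using hp.symm
    rw [this]; exact isAddUnit_zero
  obtain ⟨q, hq⟩ := exists_eq_X_pow_add (p := p) (i := p.natDegree) (by simpa using hp0)
  let u : cyclicMonoid α := ⟨aeval α (X ^ p.natDegree : ℕ[X]), ⟨_, rfl⟩⟩
  let v : cyclicMonoid α := ⟨aeval α q, ⟨_, rfl⟩⟩
  have huv : z = u + v := by
    ext
    rw [← hp, hq, map_add]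
    simp [u, v]
  rcases hz.isAddUnit_or_isAddUnit huv with h | h
  · exact absurd (hred.eq_zero_of_isAddUnit (p := X ^ p.natDegree) rfl h) (by simp)
  · have := hred.eq_zero_of_isAddUnit (p := q) rfl h
    exact ⟨p.natDegree, by rw [this, add_zero] at hq; exact hq⟩

/-- The power `α ^ k` as an element of the monoid `M_α`. -/
noncomputable def powElem (α : ℂ) (k : ℕ) : cyclicMonoid α :=
  ⟨α ^ k, mem_cyclicMonoid.2 ⟨X ^ k, by simp⟩⟩

@[simp] theorem coe_powElem (α : ℂ) (k : ℕ) : (powElem α k : ℂ) = α ^ k := rfl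

theorem mem_atomSet_iff {α : ℂ} (hred : NoNatRelation α)
    (hinj : Function.Injective fun k : ℕ => α ^ k) {z : cyclicMonoid α} :
    z ∈ atomSet (cyclicMonoid α) ↔ ∃ k, HasUniqueRep α k ∧ powElem α k = z := by
  constructor
  · intro hz
    obtain ⟨p, hp⟩ := mem_cyclicMonoid.1 z.2
    obtain ⟨i, rfl⟩ := hred.eq_X_pow_of_mem_atomSet hz hp
    refine ⟨i, fun q hq => ?_, Subtype.ext (by simpa using hp)⟩
    obtain ⟨j, rfl⟩ := hred.eq_X_pow_of_mem_atomSet hz (p := q) (by rw [hq, ← hp]; simp)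
    rw [hinj (by simpa using hq : (fun k : ℕ => α ^ k) j = (fun k : ℕ => α ^ k) i)]
  · rintro ⟨k, hk, rfl⟩
    constructor
    · intro h
      exact absurd (hred.eq_zero_of_isAddUnit (p := X ^ k) (by simp) h) (by simp)
    · intro u v huv
      obtain ⟨p, hp⟩ := mem_cyclicMonoid.1 u.2
      obtain ⟨q, hq⟩ := mem_cyclicMonoid.1 v.2
      have h1 : p + q = X ^ k := hk _ (by
        rw [map_add, hp, hq, ← AddSubmonoid.coe_add, ← huv, coe_powElem])
      have key : ∀ {p q : ℕ[X]}, p + q = X ^ k → p.coeff k = 0 → p = 0 := by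
        intro p q h h0
        ext i
        have h2 := congrArg (fun r => r.coeff i) h
        by_cases hi : i = k
        · subst hi; simpa using h0
        · simp [coeff_X_pow, hi] at h2
          simp [h2.1]
      have h2 := congrArg (fun r => r.coeff k) h1
      simp at h2
      rcases Nat.eq_zero_or_pos (p.coeff k) with h3 | h3
      · left
        have h4 : p = 0 := key h1 h3
        have : u = 0 := by ext; rw [← hp, h4]; simp
        rw [this]; exact isAddUnit_zero
      · right
        have h4 : q = 0 := key ((add_comm q p).trans h1) (by omega)
        have : v = 0 := by ext; rw [← hq, h4]; simp
        rw [this]; exact isAddUnit_zero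

theorem HasUniqueRep.of_le {α : ℂ} {j k : ℕ} (hk : HasUniqueRep α k) (h : j ≤ k) :
    HasUniqueRep α j := by
  intro p hp
  obtain ⟨i, rfl⟩ := Nat.exists_eq_add_of_le h
  have := hk (X ^ i * p) (by rw [map_mul, hp]; simp [pow_add, mul_comm])
  rw [pow_add, mul_comm (X ^ j)] at this
  exact mul_left_cancel₀ (pow_ne_zero _ X_ne_zero) this

/-! ### Strong atoms of `ℕ₀[α]` -/

/-- The polynomial `∑ x ^ i`, the sum running over a multiset of exponents; every element of
`ℕ₀[x]` arises in this way. -/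
noncomputable def sumXPow (t : Multiset ℕ) : ℕ[X] := (t.map fun i => X ^ i).sum

theorem coeff_sumXPow (t : Multiset ℕ) (i : ℕ) : (sumXPow t).coeff i = t.count i := by
  induction t using Multiset.induction_on with
  | empty => simp [sumXPow]
  | cons a t ih =>
    have : sumXPow (a ::ₘ t) = X ^ a + sumXPow t := by simp [sumXPow]
    rw [this, coeff_add, ih, coeff_X_pow, Multiset.count_cons, add_comm]

theorem exists_sumXPow_eq (p : ℕ[X]) : ∃ t, sumXPow t = p := by
  refine ⟨∑ i ∈ p.support, Multiset.replicate (p.coeff i) i, ?_⟩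
  ext j
  rw [coeff_sumXPow, Multiset.count_sum']
  simp [Multiset.count_replicate]
  exact fun h => h.symm

theorem aeval_sumXPow (α : ℂ) (t : Multiset ℕ) :
    aeval α (sumXPow t) = (((t.map (powElem α)).sum : cyclicMonoid α) : ℂ) := by
  induction t using Multiset.induction_on with
  | empty => simp [sumXPow]
  | cons a t ih =>
    have : sumXPow (a ::ₘ t) = X ^ a + sumXPow t := by simp [sumXPow]
    simp [this, ih]

/-- When the atoms of `M_α` are the powers `α ^ i` with `i < N`, strength of the atom `α ^ j` can be
tested on polynomials of degree less than `N`. -/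
theorem powElem_mem_strongAtomSet_iff {α : ℂ} {N : ℕ}
    (hinj : Function.Injective fun k : ℕ => α ^ k)
    (hat : atomSet (cyclicMonoid α) = powElem α '' {k | k < N}) {j : ℕ} (hj : j < N) :
    powElem α j ∈ strongAtomSet (cyclicMonoid α) ↔
      ∀ n : ℕ, 1 ≤ n → ∀ p : ℕ[X], p.degree < N → aeval α p = n * α ^ j →
        p = monomial j n := by
  have hinj' : Function.Injective (powElem α) := fun a b h => hinj (congrArg Subtype.val h)
  have hja : powElem α j ∈ atomSet (cyclicMonoid α) := by rw [hat]; exact ⟨j, hj, rfl⟩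
  constructor
  · rintro ⟨-, h⟩ n hn p hp hpa
    obtain ⟨t, rfl⟩ := exists_sumXPow_eq p
    have ht : t.map (powElem α) = Multiset.replicate n (powElem α j) := by
      refine h n hn _ ?_ ?_
      · intro b hb
        obtain ⟨i, hi, rfl⟩ := Multiset.mem_map.1 hb
        rw [hat]
        refine ⟨i, ?_, rfl⟩
        by_contra hiN
        have := coeff_eq_zero_of_degree_lt (hp.trans_le (Nat.cast_le.2 (not_lt.1 hiN)))
        rw [coeff_sumXPow] at this
        exact (Multiset.count_eq_zero.1 this) hi
      · ext
        rw [← aeval_sumXPow, hpa]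
        simp
    rw [← Multiset.map_replicate] at ht
    rw [Multiset.map_injective hinj' ht]
    ext i
    simp [coeff_sumXPow, Multiset.count_replicate, coeff_monomial]
  · refine fun h => ⟨hja, fun n hn s hs hsum => ?_⟩
    obtain ⟨t, ht, rfl⟩ : ∃ t : Multiset ℕ, (∀ i ∈ t, i < N) ∧ t.map (powElem α) = s := by
      clear hsum
      induction s using Multiset.induction_on with
      | empty => exact ⟨0, by simp, by simp⟩
      | cons a s ih =>
        obtain ⟨t, ht, rfl⟩ := ih fun b hb => hs b (Multiset.mem_cons_of_mem hb)
        have := hs a (Multiset.mem_cons_self _ _)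
        rw [hat] at this
        obtain ⟨i, hi, rfl⟩ := this
        refine ⟨i ::ₘ t, ?_, by simp⟩
        simpa using ⟨hi, ht⟩
    have h1 : sumXPow t = monomial j n := by
      refine h n hn _ ?_ ?_
      · rw [degree_lt_iff_coeff_zero]
        intro m hm
        rw [coeff_sumXPow, Multiset.count_eq_zero]
        exact fun hmt => absurd (ht m hmt) (by omega)
      · rw [aeval_sumXPow, hsum]
        simp
    rw [← Multiset.map_replicate]
    congr 1
    ext i
    rw [← coeff_sumXPow, h1]
    simp [Multiset.count_replicate, coeff_monomial]

/-- A unique atom is strong. -/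
theorem strongAtomSet_eq_of_atomSet_eq_singleton {α : ℂ} {a : cyclicMonoid α}
    (h : atomSet (cyclicMonoid α) = {a}) : strongAtomSet (cyclicMonoid α) = {a} := by
  have ha : a ∈ atomSet (cyclicMonoid α) := by rw [h]; rfl
  have ha0 : (a : ℂ) ≠ 0 := by
    intro h0
    apply ha.not_isAddUnit
    rw [show a = 0 from Subtype.ext h0]
    exact isAddUnit_zero
  ext b
  constructor
  · rintro ⟨hb, -⟩
    rwa [h] at hb
  · rintro rfl
    refine ⟨ha, fun n _ s hs hsum => ?_⟩
    have h1 : s = Multiset.replicate (Multiset.card s) b :=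
      Multiset.eq_replicate_card.2 fun c hc => by simpa [h] using hs c hc
    rw [h1, Multiset.sum_replicate] at hsum
    have h2 := congrArg Subtype.val hsum
    simp [ha0] at h2
    rw [h1, h2]

/-! ### Polynomials without positive roots -/

/-- A positive definite binary quadratic form dominates every linear form at large arguments. -/
theorem exists_quadratic_form_ge {a b c : ℝ} (ha : 0 < a) (hc : 0 < c) (h : b ^ 2 < 4 * a * c) :
    ∃ K : ℝ, ∀ J L : ℝ, 0 ≤ J → 0 ≤ L → K ≤ J + L →
      0 ≤ a * J ^ 2 + b * J * L + c * L ^ 2 - a * J - c * L := by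
  have hac : 0 < a + c := by positivity
  obtain ⟨ε, hε⟩ : ∃ ε, ε = (a * c - b ^ 2 / 4) / (a + c) := ⟨_, rfl⟩
  have hε0 : 0 < ε := hε ▸ div_pos (by linarith) hac
  have hεe : ε * (a + c) = a * c - b ^ 2 / 4 := by rw [hε]; field_simp
  have hεa : 0 < a - ε := by
    have : 0 < (a - ε) * (a + c) := by nlinarith [sq_nonneg b]
    exact pos_of_mul_pos_left this hac.le
  refine ⟨2 * (a + c) / ε, fun J L hJ hL hK => ?_⟩
  rw [div_le_iff₀ hε0] at hK
  have h1 : 0 ≤ (a - ε) * J ^ 2 + b * J * L + (c - ε) * L ^ 2 := by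
    have : 0 ≤ (a - ε) * ((a - ε) * J ^ 2 + b * J * L + (c - ε) * L ^ 2) := by
      have e : (a - ε) * ((a - ε) * J ^ 2 + b * J * L + (c - ε) * L ^ 2) =
          ((a - ε) * J + b * L / 2) ^ 2 + ε ^ 2 * L ^ 2 := by
        linear_combination (-L ^ 2) * hεe
      rw [e]; positivity
    exact nonneg_of_mul_nonneg_right this hεa
  have h2 : (a + c) * (J + L) ≤ ε * (J ^ 2 + L ^ 2) := by
    nlinarith [mul_le_mul_of_nonneg_right hK (add_nonneg hJ hL),
      mul_nonneg hε0.le (sq_nonneg (J - L))]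
  nlinarith [mul_nonneg ha.le hL, mul_nonneg hc.le hJ]

theorem exists_one_add_X_pow_mul_quadratic {a b c : ℝ} (ha : 0 < a) (hc : 0 < c)
    (h : b ^ 2 < 4 * a * c) :
    ∃ k : ℕ, ∀ j, 0 ≤ ((1 + X) ^ k * (C a * X ^ 2 + C b * X + C c)).coeff j := by
  obtain ⟨K, hK⟩ := exists_quadratic_form_ge ha hc h
  obtain ⟨k, hk⟩ := exists_nat_ge (max K (|b| / c))
  have hkK : K ≤ k := (le_max_left _ _).trans hk
  have hkb : |b| ≤ k * c := (div_le_iff₀ hc).1 ((le_max_right _ _).trans hk)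
  refine ⟨k, fun j => ?_⟩
  have e : (1 + X) ^ k * (C a * X ^ 2 + C b * X + C c) =
      C a * ((1 + X) ^ k * X ^ 2) + C b * ((1 + X) ^ k * X) + C c * (1 + X) ^ k := by ring
  rw [e]
  match j with
  | 0 =>
    simp [coeff_one_add_X_pow]
    exact hc.le
  | 1 =>
    have := coeff_mul_X ((1 + X : ℝ[X]) ^ k) 0
    rw [zero_add] at this
    simp [coeff_one_add_X_pow, coeff_mul_X_pow', this]
    nlinarith [neg_abs_le b]
  | j + 2 =>
    have h1 := coeff_mul_X ((1 + X : ℝ[X]) ^ k) (j + 1)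
    have h2 := coeff_mul_X_pow ((1 + X : ℝ[X]) ^ k) 2 j
    simp only [coeff_add, coeff_C_mul, h2, h1, coeff_one_add_X_pow]
    rcases lt_or_ge k j with hkj | hkj
    · simp [Nat.choose_eq_zero_of_lt hkj, Nat.choose_eq_zero_of_lt (show k < j + 1 by omega),
        Nat.choose_eq_zero_of_lt (show k < j + 2 by omega)]
    obtain ⟨L, rfl⟩ := Nat.exists_eq_add_of_le hkj
    -- Up to the factor `(j + 1) * (j + 2)`, the coefficient is a binomial coefficient times the
    -- quadratic form at `(j + 2, L)` minus linear terms.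
    have e3 : ((j + L).choose (j + 1) : ℝ) * (j + 1) = (j + L).choose j * L := by
      have := Nat.choose_succ_right_eq (j + L) j
      rw [Nat.add_sub_cancel_left] at this
      exact_mod_cast this
    have e4 : ((j + L).choose (j + 2) : ℝ) * (j + 2) = (j + L).choose (j + 1) * (L - 1) := by
      have := Nat.choose_succ_right_eq (j + L) (j + 1)
      rcases L with _ | L
      · simp [Nat.choose_eq_zero_of_lt (show j < j + 2 by omega)]
      · rw [show j + (L + 1) - (j + 1) = L by omega] at this
        push_cast
        rw [add_sub_cancel_right]
        exact_mod_cast this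
    have hq := hK (j + 2) L (by positivity) (by positivity) (by push_cast at hkK; linarith)
    have hj1 : (0 : ℝ) < (j + 1) * (j + 2) := by positivity
    refine nonneg_of_mul_nonneg_right (a := ((j : ℝ) + 1) * (j + 2)) ?_ hj1
    have e5 : ((j : ℝ) + 1) * (j + 2) * (a * (j + L).choose j + b * (j + L).choose (j + 1) +
        c * (j + L).choose (j + 2)) = (j + L).choose j * (a * (j + 2 : ℝ) ^ 2 + b * (j + 2) * L +
          c * L ^ 2 - a * (j + 2) - c * L) := by
      linear_combination (b * (j + 2) + c * (L - 1)) * e3 + c * (j + 1) * e4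
    rw [e5]
    positivity

/-- Up to a nonzero constant, some product with a power of `1 + x` has nonnegative coefficients. -/
def HasNonnegMultiple (f : ℝ[X]) : Prop :=
  ∃ (k : ℕ) (s : ℝ), s ≠ 0 ∧ ∀ j, 0 ≤ (C s * ((1 + X) ^ k * f)).coeff j

theorem HasNonnegMultiple.mul {f g : ℝ[X]} (hf : HasNonnegMultiple f) (hg : HasNonnegMultiple g) :
    HasNonnegMultiple (f * g) := by
  obtain ⟨k, s, hs, h⟩ := hf
  obtain ⟨l, t, ht, h'⟩ := hg
  refine ⟨k + l, s * t, mul_ne_zero hs ht, fun j => ?_⟩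
  have e : C (s * t) * ((1 + X) ^ (k + l) * (f * g)) =
      (C s * ((1 + X) ^ k * f)) * (C t * ((1 + X) ^ l * g)) := by
    rw [C_mul]; ring
  rw [e, coeff_mul]
  exact Finset.sum_nonneg fun x _ => mul_nonneg (h _) (h' _)

theorem HasNonnegMultiple.of_irreducible {f : ℝ[X]} (hf : Irreducible f)
    (hr : ∀ x : ℝ, 0 < x → f.eval x ≠ 0) : HasNonnegMultiple f := by
  have h2 : f.natDegree ≤ 2 := natDegree_le_of_degree_le hf.degree_le_two
  have h1 := hf.natDegree_pos
  have hlc : f.leadingCoeff ≠ 0 := by simpa using hf.ne_zero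
  rcases (show f.natDegree = 1 ∨ f.natDegree = 2 by omega) with hd | hd
  · rw [leadingCoeff, hd] at hlc
    refine ⟨0, (f.coeff 1)⁻¹, inv_ne_zero hlc, fun j => ?_⟩
    have hroot : 0 ≤ f.coeff 0 / f.coeff 1 := by
      by_contra! hneg
      apply hr (-(f.coeff 0 / f.coeff 1)) (by linarith)
      rw [eval_eq_sum_range, hd]
      simp [Finset.sum_range_succ]
      field_simp
      ring
    rw [pow_zero, one_mul, coeff_C_mul]
    match j with
    | 0 => rwa [mul_comm, ← div_eq_mul_inv]
    | 1 => rw [inv_mul_cancel₀ hlc]; exact zero_le_one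
    | j + 2 =>
      have h0 : f.coeff (j + 2) = 0 := coeff_eq_zero_of_natDegree_lt (by omega)
      rw [h0, mul_zero]
  · rw [leadingCoeff, hd] at hlc
    obtain ⟨b, hb⟩ : ∃ b, b = (f.coeff 2)⁻¹ * f.coeff 1 := ⟨_, rfl⟩
    obtain ⟨c, hc⟩ : ∃ c, c = (f.coeff 2)⁻¹ * f.coeff 0 := ⟨_, rfl⟩
    have hfe : C (f.coeff 2)⁻¹ * f = C 1 * X ^ 2 + C b * X + C c := by
      ext j
      rw [coeff_C_mul]
      match j with
      | 0 => simp [hc]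
      | 1 => simp [hb]
      | 2 => simp [hlc]
      | j + 3 =>
        have h0 : f.coeff (j + 3) = 0 := coeff_eq_zero_of_natDegree_lt (by omega)
        simp [h0]
    have hnoroot : ∀ x : ℝ, x ^ 2 + b * x + c ≠ 0 := by
      intro x hx
      have hx' := congrArg (eval x) hfe
      simp at hx'
      rw [hx] at hx'
      have : IsRoot f x := by simpa [hlc] using hx'
      have := degree_eq_one_of_irreducible_of_root hf this
      rw [degree_eq_natDegree hf.ne_zero, hd] at this
      exact absurd this (by norm_num)
    have hdisc : b ^ 2 < 4 * 1 * c := by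
      by_contra! hge
      apply hnoroot ((-b + √(b ^ 2 - 4 * c)) / 2)
      have := Real.sq_sqrt (show 0 ≤ b ^ 2 - 4 * c by linarith)
      linear_combination this / 4
    have hc0 : 0 < c := by nlinarith [sq_nonneg b]
    obtain ⟨k, hk⟩ := exists_one_add_X_pow_mul_quadratic one_pos hc0 hdisc
    refine ⟨k, (f.coeff 2)⁻¹, inv_ne_zero hlc, fun j => ?_⟩
    rw [← mul_assoc, mul_comm (C _), mul_assoc, hfe]
    exact hk j

theorem HasNonnegMultiple.of_no_pos_root (f : ℝ[X]) (hf : f ≠ 0)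
    (hr : ∀ x : ℝ, 0 < x → f.eval x ≠ 0) : HasNonnegMultiple f := by
  induction f using WfDvdMonoid.induction_on_irreducible with
  | zero => exact absurd rfl hf
  | unit u hu =>
    obtain ⟨r, hu', rfl⟩ := Polynomial.isUnit_iff.1 hu
    refine ⟨0, r⁻¹, inv_ne_zero hu'.ne_zero, fun j => ?_⟩
    rw [pow_zero, one_mul, ← C_mul, inv_mul_cancel₀ hu'.ne_zero, coeff_C]
    split_ifs <;> norm_num
  | mul a i ha hi ih =>
    refine HasNonnegMultiple.mul (.of_irreducible hi fun x hx h0 => hr x hx (by simp [h0]))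
      (ih ha fun x hx h0 => hr x hx (by simp [h0]))

theorem NoNatRelation.of_nonneg_coeff {α : ℂ} (hred : NoNatRelation α) {q : ℚ[X]}
    (hq : ∀ i, 0 ≤ q.coeff i) (h : aeval α q = 0) : q = 0 := by
  -- Clearing denominators turns `q` into a polynomial over `ℕ`.
  obtain ⟨D, hD⟩ : ∃ D, D = ∏ i ∈ q.support, (q.coeff i).den := ⟨_, rfl⟩
  have hD0 : (D : ℚ) ≠ 0 := by
    rw [hD, Nat.cast_ne_zero]
    exact Finset.prod_ne_zero_iff.2 fun i _ => (q.coeff i).den_ne_zero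
  have hlift : C (D : ℚ) * q ∈ Polynomial.lifts (Nat.castRingHom ℚ) := by
    rw [lifts_iff_coeff_lifts]
    intro i
    rw [coeff_C_mul]
    by_cases hi : i ∈ q.support
    · obtain ⟨e, he⟩ : (q.coeff i).den ∣ D := hD ▸ Finset.dvd_prod_of_mem _ hi
      refine ⟨e * (q.coeff i).num.toNat, ?_⟩
      have h1 : (((q.coeff i).num.toNat : ℕ) : ℚ) = (q.coeff i).num := by
        exact_mod_cast Int.toNat_of_nonneg (Rat.num_nonneg.2 (hq i))
      have h2 := Rat.den_mul_eq_num (q.coeff i)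
      simp only [eq_natCast, Nat.cast_mul, h1, he]
      rw [← h2]; ring
    · rw [notMem_support_iff.1 hi, mul_zero]
      exact ⟨0, by simp⟩
  obtain ⟨p, hp⟩ := (mem_lifts _).1 hlift
  have hp0 : p = 0 := by
    apply hred
    have h1 : aeval α (p.map (Nat.castRingHom ℚ)) = 0 := by rw [hp, map_mul, h, mul_zero]
    rwa [show Nat.castRingHom ℚ = algebraMap ℕ ℚ from rfl, aeval_map_algebraMap] at h1
  rw [hp0, Polynomial.map_zero] at hp
  exact (mul_eq_zero.1 hp.symm).resolve_left (by simpa using hD0)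

/-- An algebraic number satisfying no relation with nonnegative coefficients has a positive
conjugate. -/
theorem NoNatRelation.exists_pos_root {α : ℂ} (hred : NoNatRelation α) (hα : IsAlgebraic ℚ α) :
    ∃ r : ℝ, 0 < r ∧ aeval r (minpoly ℚ α) = 0 := by
  by_contra! hno
  have hm := minpoly.monic hα.isIntegral
  obtain ⟨k, s, hs, h⟩ := HasNonnegMultiple.of_no_pos_root ((minpoly ℚ α).map (algebraMap ℚ ℝ))
    (hm.map _).ne_zero fun x hx => by
      rw [eval_map_algebraMap]
      exact hno x hx
  have hmon : Monic ((1 + X) ^ k * minpoly ℚ α) := by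
    refine Monic.mul (Monic.pow ?_ k) hm
    rw [add_comm]; exact monic_X_add_C 1
  have hmap : (1 + X) ^ k * (minpoly ℚ α).map (algebraMap ℚ ℝ) =
      ((1 + X) ^ k * minpoly ℚ α).map (algebraMap ℚ ℝ) := by simp
  simp only [hmap, coeff_C_mul, coeff_map] at h
  have hs0 : 0 < s := by
    have := h ((1 + X) ^ k * minpoly ℚ α).natDegree
    rw [hmon.coeff_natDegree, map_one, mul_one] at this
    exact lt_of_le_of_ne this hs.symm
  refine hmon.ne_zero (hred.of_nonneg_coeff (fun i => ?_) ?_)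
  · have := nonneg_of_mul_nonneg_right (h i) hs0
    simpa using this
  · rw [map_mul, minpoly.aeval, mul_zero]

/-! ### Finitely many atoms -/

theorem aeval_eq_zero_of_minpoly {α : ℂ} {r : ℝ} (hr : aeval r (minpoly ℚ α) = 0) {p : ℤ[X]}
    (hp : aeval α p = 0) : aeval r p = 0 := by
  have h1 : minpoly ℚ α ∣ p.map (algebraMap ℤ ℚ) :=
    minpoly.dvd _ _ (by rwa [aeval_map_algebraMap])
  have h2 := aeval_eq_zero_of_dvd_aeval_eq_zero h1 hr
  rwa [aeval_map_algebraMap] at h2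

theorem aeval_map_natCast {A : Type*} [CommRing A] (x : A) (p : ℕ[X]) :
    aeval x (p.map (Nat.castRingHom ℤ)) = aeval x p := by
  rw [aeval_def, aeval_def, eval₂_map]
  congr 1
  ext
  simp

theorem aeval_eq_of_minpoly {α : ℂ} {r : ℝ} (hr : aeval r (minpoly ℚ α) = 0) {p q : ℕ[X]}
    (h : aeval α p = aeval α q) : aeval r p = aeval r q := by
  have := aeval_eq_zero_of_minpoly hr
    (p := p.map (Nat.castRingHom ℤ) - q.map (Nat.castRingHom ℤ))
    (by rw [map_sub, aeval_map_natCast, aeval_map_natCast, h, sub_self])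
  rwa [map_sub, aeval_map_natCast, aeval_map_natCast, sub_eq_zero] at this

theorem ne_one_of_minpoly {α : ℂ} (hα : IsAlgebraic ℚ α) (h1 : α ≠ 1) {r : ℝ}
    (hr : aeval r (minpoly ℚ α) = 0) : r ≠ 1 := by
  rintro rfl
  apply h1
  have h2 : IsRoot (minpoly ℚ α) 1 := by
    have h3 : aeval (algebraMap ℚ ℝ 1) (minpoly ℚ α) = 0 := by rwa [map_one]
    rw [aeval_algebraMap_apply] at h3
    simpa using h3
  have := minpoly.root hα.isIntegral h2
  simpa using this.symm

theorem pow_injective_of_minpoly {α : ℂ} {r : ℝ} (hr0 : 0 < r) (hr1 : r ≠ 1)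
    (hr : aeval r (minpoly ℚ α) = 0) : Function.Injective fun k : ℕ => α ^ k := by
  intro i j hij
  have := aeval_eq_of_minpoly hr (p := X ^ i) (q := X ^ j) (by simpa using hij)
  exact pow_right_injective₀ hr0 hr1 (by simpa using this)

theorem aeval_nonneg {r : ℝ} (hr : 0 ≤ r) (p : ℕ[X]) : 0 ≤ aeval r p := by
  rw [aeval_eq_sum_range]
  exact Finset.sum_nonneg fun i _ => by positivity

theorem pow_le_aeval {r : ℝ} (hr : 0 ≤ r) {p : ℕ[X]} {i : ℕ} (h : p.coeff i ≠ 0) :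
    r ^ i ≤ aeval r p := by
  obtain ⟨q, rfl⟩ := exists_eq_X_pow_add h
  have := aeval_nonneg hr q
  simp
  exact this

theorem degree_lt_of_aeval_eq_pow {r : ℝ} (hr : 1 < r) {p : ℕ[X]} {N : ℕ}
    (hp : aeval r p = r ^ N) (hN : p.coeff N = 0) : p.degree < N := by
  rw [degree_lt_iff_coeff_zero]
  intro i hi
  rcases hi.lt_or_eq with hi | rfl
  · by_contra hc
    have h1 := pow_le_aeval (zero_le_one.trans hr.le) hc
    rw [hp] at h1
    exact absurd (pow_lt_pow_right₀ hr hi) (not_lt.2 h1)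
  · exact hN

/-- A lower set of `ℕ` with `N` elements is `{k | k < N}`. -/
theorem eq_setOf_lt_of_encard_eq {S : Set ℕ} (hS : ∀ {j k}, k ∈ S → j ≤ k → j ∈ S) {N : ℕ}
    (h : S.encard = N) : S = {k | k < N} := by
  have hfin : S.Finite := Set.finite_of_encard_eq_coe h
  obtain ⟨k, hk, hmin⟩ : ∃ k, k ∉ S ∧ ∀ j < k, j ∈ S := by
    classical
    have hex : ∃ k, k ∉ S := hfin.infinite_compl.nonempty
    exact ⟨Nat.find hex, Nat.find_spec hex, fun j hj => not_not.1 (Nat.find_min hex hj)⟩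
  have hSk : S = {j | j < k} := by
    ext j
    exact ⟨fun hj => not_le.1 fun hkj => hk (hS hj hkj), hmin j⟩
  have hcard : ({j | j < k} : Set ℕ).encard = k := by
    rw [show {j | j < k} = (Finset.range k : Set ℕ) by ext; simp,
      Set.encard_coe_eq_coe_finsetCard, Finset.card_range]
  rw [hSk, hcard, Nat.cast_inj] at h
  rw [hSk, h]

/-- If `1` is an atom of `M_α` and `α ^ N` is not, then `α ^ N` is a sum of smaller powers of `α`. -/
theorem exists_degree_lt_of_not_hasUniqueRep {α : ℂ} (hred : NoNatRelation α) {r : ℝ}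
    (hr0 : 0 < r) (hr1 : r ≠ 1) (hr : aeval r (minpoly ℚ α) = 0) {N : ℕ}
    (h0 : HasUniqueRep α 0) (hN : ¬ HasUniqueRep α N) :
    ∃ p : ℕ[X], p.degree < N ∧ aeval α p = α ^ N := by
  obtain ⟨p, hp, hpN⟩ : ∃ p : ℕ[X], aeval α p = α ^ N ∧ p ≠ X ^ N := by
    by_contra! h
    exact hN h
  have hpr : aeval r p = r ^ N := by
    simpa using aeval_eq_of_minpoly hr (p := p) (q := X ^ N) (by simpa using hp)
  have hcN : p.coeff N = 0 := by
    by_contra h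
    obtain ⟨q, rfl⟩ := exists_eq_X_pow_add h
    rw [map_add, map_pow, aeval_X, add_eq_left] at hp
    exact hpN (by rw [hred q hp, add_zero])
  rcases lt_or_gt_of_ne hr1 with h | h
  · exfalso
    obtain ⟨q, rfl⟩ : X ^ (N + 1) ∣ p := by
      refine X_pow_dvd_iff.2 fun i hi => ?_
      rcases (Nat.lt_succ_iff.1 hi).lt_or_eq with hi | rfl
      · by_contra hc
        have h1 := pow_le_aeval hr0.le hc
        rw [hpr] at h1
        exact absurd (pow_lt_pow_right_of_lt_one₀ hr0 h hi) (not_lt.2 h1)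
      · exact hcN
    rw [map_mul, map_pow, aeval_X, pow_succ, mul_assoc] at hp
    have h1 : α * aeval α q = 1 :=
      mul_left_cancel₀ (pow_ne_zero N hred.ne_zero) (by rw [hp, mul_one])
    have h2 := h0 (X * q) (by simpa using h1)
    have h3 := congrArg (fun r => r.coeff 0) h2
    simp at h3
  · exact ⟨p, degree_lt_of_aeval_eq_pow h hpr hcN, hp⟩

/-- If `α ^ d` is an atom, with `d` the degree of `α`, then the minimal polynomial of `α` has a
positive coefficient below the leading one. -/
theorem HasUniqueRep.exists_coeff_pos {α : ℂ} {m : ℤ[X]} (hm : m.Monic) (hmα : aeval α m = 0)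
    (h : HasUniqueRep α m.natDegree) : ∃ i < m.natDegree, 0 < m.coeff i := by
  by_contra! hneg
  obtain ⟨p, hp⟩ : ∃ p : ℕ[X], p.map (Nat.castRingHom ℤ) = X ^ m.natDegree - m := by
    rw [← mem_lifts, lifts_iff_coeff_lifts]
    intro i
    refine ⟨(-m.coeff i).toNat, ?_⟩
    rw [coeff_sub, coeff_X_pow]
    rcases lt_trichotomy i m.natDegree with hi | rfl | hi
    · simp [hi.ne, hneg i hi]
    · simp [hm]
    · simp [hi.ne', coeff_eq_zero_of_natDegree_lt hi]
  have h1 : p = X ^ m.natDegree := h p (by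
    rw [← aeval_map_natCast, hp, map_sub, hmα]; simp)
  have h2 := congrArg (fun q => q.coeff m.natDegree) hp
  simp [h1, hm] at h2

theorem eq_of_monic_natDegree_one {f : ℤ[X]} (hf : f.Monic) (hd : f.natDegree = 1) :
    f = X + C (f.coeff 0) := by
  conv_lhs => rw [f.as_sum_range_C_mul_X_pow, hd]
  have : f.coeff 1 = 1 := by rw [← hd]; exact hf
  simp [Finset.sum_range_succ, this]
  ring

theorem eq_of_monic_natDegree_two {f : ℤ[X]} (hf : f.Monic) (hd : f.natDegree = 2) :
    f = X ^ 2 + C (f.coeff 1) * X + C (f.coeff 0) := by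
  conv_lhs => rw [f.as_sum_range_C_mul_X_pow, hd]
  have : f.coeff 2 = 1 := by rw [← hd]; exact hf
  simp [Finset.sum_range_succ, this]
  ring

theorem eq_of_monic_natDegree_three {f : ℤ[X]} (hf : f.Monic) (hd : f.natDegree = 3) :
    f = X ^ 3 + C (f.coeff 2) * X ^ 2 + C (f.coeff 1) * X + C (f.coeff 0) := by
  conv_lhs => rw [f.as_sum_range_C_mul_X_pow, hd]
  have : f.coeff 3 = 1 := by rw [← hd]; exact hf
  simp [Finset.sum_range_succ, this]
  ring

/-! ### The case of at most four atoms -/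

/-- No quadratic `x² + a x + b` with a positive root and a positive nonleading coefficient divides a
cubic whose nonleading coefficients are nonpositive. -/
theorem quadratic_not_dvd_cubic {a b e : ℤ} {r : ℝ} (hr0 : 0 < r) (hr : r ^ 2 + a * r + b = 0)
    (hb : b ≠ 0) (hpos : 0 < a ∨ 0 < b) (h2 : a + e ≤ 0) (h1 : b + a * e ≤ 0) (h0 : b * e ≤ 0) :
    False := by
  rcases lt_or_gt_of_ne hb with hb | hb
  · have ha : 0 < a := by omega
    nlinarith
  · have ha : a < 0 := by
      by_contra! ha
      have ha' : (0 : ℝ) ≤ a := by exact_mod_cast ha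
      have hb' : (0 : ℝ) < b := by exact_mod_cast hb
      nlinarith [mul_nonneg ha' hr0.le, sq_nonneg r]
    have he : e ≤ 0 := by
      by_contra! he
      nlinarith [mul_pos hb he]
    nlinarith [mul_nonneg_of_nonpos_of_nonpos ha.le he]

/-- The analogue of `quadratic_not_dvd_cubic` for a quartic, with quadratic cofactor
`x² + e x + g`. -/
theorem quadratic_not_dvd_quartic {a b e g : ℤ} {r : ℝ} (hr0 : 0 < r)
    (hr : r ^ 2 + a * r + b = 0) (hb : b ≠ 0) (hpos : 0 < a ∨ 0 < b) (h3 : a + e ≤ 0)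
    (h2 : b + a * e + g ≤ 0) (h1 : b * e + a * g ≤ 0) (h0 : b * g ≤ 0) : False := by
  rcases lt_or_gt_of_ne hb with hb | hb
  · have ha : 0 < a := by omega
    have he : e < 0 := by omega
    have hg : 0 ≤ g := by
      by_contra! hg
      nlinarith [mul_pos_of_neg_of_neg hb hg]
    nlinarith [mul_pos_of_neg_of_neg hb he, mul_nonneg ha.le hg]
  · have ha : a < 0 := by
      by_contra! ha
      have ha' : (0 : ℝ) ≤ a := by exact_mod_cast ha
      have hb' : (0 : ℝ) < b := by exact_mod_cast hb
      nlinarith [mul_nonneg ha' hr0.le, sq_nonneg r]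
    have hg : g ≤ 0 := by
      by_contra! hg
      nlinarith [mul_pos hb hg]
    have he : e ≤ 0 := by
      by_contra! he
      nlinarith [mul_pos hb he, mul_nonneg_of_nonpos_of_nonpos ha.le hg]
    have hg : g < 0 := by nlinarith [mul_nonneg_of_nonpos_of_nonpos ha.le he]
    have he : e < 0 := by
      by_contra! he
      nlinarith [mul_nonneg hb.le he, mul_pos_of_neg_of_neg ha hg]
    -- The quadratic has a real root, so its discriminant is nonnegative.
    have hdisc : 4 * b ≤ a ^ 2 := by
      have : (4 * b : ℝ) ≤ a ^ 2 := by nlinarith [sq_nonneg (2 * r + a)]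
      exact_mod_cast this
    nlinarith [mul_le_mul_of_nonpos_left h2 ha.le, mul_le_mul_of_nonpos_right hdisc he.le,
      mul_pos_of_neg_of_neg ha hg, mul_neg_of_pos_of_neg hb he, mul_neg_of_neg_of_pos ha hb]

/-- If the cubic `x³ + a x² + b x + c` with a positive root and a positive nonleading coefficient
divides a quartic whose nonleading coefficients are nonpositive, then its signs alternate. -/
theorem cubic_signs {a b c e : ℤ} {r : ℝ} (hr0 : 0 < r)
    (hr : r ^ 3 + a * r ^ 2 + b * r + c = 0) (hc : c ≠ 0) (hpos : 0 < a ∨ 0 < b ∨ 0 < c)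
    (h3 : a + e ≤ 0) (h2 : b + a * e ≤ 0) (h1 : c + b * e ≤ 0) (h0 : c * e ≤ 0) :
    a < 0 ∧ 0 < b ∧ c < 0 := by
  rcases lt_or_gt_of_ne hc with hc | hc
  · have he : 0 ≤ e := by
      by_contra! he
      nlinarith [mul_pos_of_neg_of_neg hc he]
    have hb : 0 < b := by omega
    have ha : a < 0 := by
      by_contra! ha
      nlinarith [mul_nonneg ha he]
    exact ⟨ha, hb, hc⟩
  · exfalso
    have he : e ≤ 0 := by
      by_contra! he
      nlinarith [mul_pos hc he]
    have hb : 0 < b := by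
      by_contra! hb
      nlinarith [mul_nonneg_of_nonpos_of_nonpos hb he]
    have ha : 0 < a := by
      by_contra! ha
      nlinarith [mul_nonneg_of_nonpos_of_nonpos ha he]
    have ha' : (0 : ℝ) < a := by exact_mod_cast ha
    have hb' : (0 : ℝ) < b := by exact_mod_cast hb
    have hc' : (0 : ℝ) < c := by exact_mod_cast hc
    have : 0 < r ^ 3 + a * r ^ 2 + b * r + c := by positivity
    exact this.ne' hr

/-- If the powers `α ^ k`, `k < N ≤ 4`, are the atoms of `M_α`, then a relation of degree less than
`N` with at most one negative coefficient is trivial. The monic relation `x ^ N - p` and `h` are both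
multiples of the minimal polynomial, and the signs of the coefficients of the first one leave no
room for the second. -/
theorem eq_zero_of_coeff_nonneg {α : ℂ} (hα : α ≠ 0) {r : ℝ} (hr0 : 0 < r)
    (hr : aeval r (minpoly ℚ α) = 0) {N : ℕ} (hN4 : N ≤ 4)
    (hE : ∀ k < N, HasUniqueRep α k) {p : ℕ[X]} (hpN : p.degree < N) (hp : aeval α p = α ^ N)
    {h : ℤ[X]} {j : ℕ} (hh : ∀ i, i ≠ j → 0 ≤ h.coeff i) (hhN : h.degree < N)
    (hhα : aeval α h = 0) : h = 0 := by
  by_contra hh0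
  obtain ⟨f, hf⟩ : ∃ f : ℤ[X], f = X ^ N - p.map (Nat.castRingHom ℤ) := ⟨_, rfl⟩
  have hpN' : (p.map (Nat.castRingHom ℤ)).degree < N := degree_map_le.trans_lt hpN
  have hfm : f.Monic := hf ▸ monic_X_pow_sub hpN'
  have hfN : f.natDegree = N := by
    apply natDegree_eq_of_degree_eq_some
    rw [hf, degree_sub_eq_left_of_degree_lt (by rwa [degree_X_pow]), degree_X_pow]
  have hfα : aeval α f = 0 := by
    rw [hf, map_sub, aeval_map_natCast, hp]; simp
  have hfi : ∀ i < N, f.coeff i ≤ 0 := by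
    intro i hi
    rw [hf, coeff_sub, coeff_X_pow, if_neg hi.ne]
    simp
  have hint : IsIntegral ℤ α := ⟨f, hfm, hfα⟩
  obtain ⟨m, hm⟩ : ∃ m, m = minpoly ℤ α := ⟨_, rfl⟩
  have hmm : m.Monic := hm ▸ minpoly.monic hint
  have hmα : aeval α m = 0 := hm ▸ minpoly.aeval _ _
  have hmr : aeval r m = 0 := aeval_eq_zero_of_minpoly hr hmα
  have hm0 : m.coeff 0 ≠ 0 := by
    have h1 := minpoly.coeff_zero_ne_zero (A := ℚ) hint.tower_top hα
    rw [minpoly.isIntegrallyClosed_eq_field_fractions' ℚ hint, ← hm, coeff_map] at h1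
    exact fun h0 => h1 (by rw [h0, map_zero])
  have hmpos : 0 < m.natDegree := hm ▸ minpoly.natDegree_pos hint
  obtain ⟨g, hg⟩ : m ∣ f := hm ▸ minpoly.isIntegrallyClosed_dvd hint hfα
  obtain ⟨t, ht⟩ : m ∣ h := hm ▸ minpoly.isIntegrallyClosed_dvd hint hhα
  have hgm : g.Monic := hmm.of_mul_monic_left (hg ▸ hfm)
  have hdeg : N = m.natDegree + g.natDegree := by
    rw [← hfN, hg, hmm.natDegree_mul hgm]
  have ht0 : t ≠ 0 := by rintro rfl; exact hh0 (by rw [ht, mul_zero])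
  have hdegh : h.natDegree = m.natDegree + t.natDegree := by
    rw [ht, hmm.natDegree_mul' ht0]
  have hhN' : h.natDegree < N := (natDegree_lt_iff_degree_lt hh0).2 hhN
  obtain ⟨i, hi, hipos⟩ := (hE m.natDegree (by omega)).exists_coeff_pos hmm hmα
  have hd : m.natDegree = 1 ∨ m.natDegree = 2 ∧ g.natDegree = 1 ∨
      m.natDegree = 2 ∧ g.natDegree = 2 ∨ m.natDegree = 3 ∧ g.natDegree = 1 := by omega
  rcases hd with hd | ⟨hd, hd'⟩ | ⟨hd, hd'⟩ | ⟨hd, hd'⟩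
  · rw [eq_of_monic_natDegree_one hmm hd] at hmr
    obtain rfl : i = 0 := by omega
    have : (0 : ℝ) < m.coeff 0 := by exact_mod_cast hipos
    simp at hmr
    linarith
  · have hme := eq_of_monic_natDegree_two hmm hd
    rw [eq_of_monic_natDegree_one hgm hd', hme] at hg
    rw [hme] at hmr
    have hfe : f = X ^ 3 + C (m.coeff 1 + g.coeff 0) * X ^ 2 +
        C (m.coeff 0 + m.coeff 1 * g.coeff 0) * X + C (m.coeff 0 * g.coeff 0) := by
      rw [hg]; simp only [C_add, C_mul]; ring
    have c0 := hfi 0 (by omega)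
    have c1 := hfi 1 (by omega)
    have c2 := hfi 2 (by omega)
    simp only [hfe, coeff_add, coeff_C_mul, coeff_X_pow, coeff_X, coeff_C] at c0 c1 c2
    norm_num at c0 c1 c2
    refine quadratic_not_dvd_cubic hr0 (by simpa using hmr) hm0 ?_ c2 c1 c0
    rcases (show i = 0 ∨ i = 1 by omega) with rfl | rfl
    · exact Or.inr hipos
    · exact Or.inl hipos
  · have hme := eq_of_monic_natDegree_two hmm hd
    rw [eq_of_monic_natDegree_two hgm hd', hme] at hg
    rw [hme] at hmr
    have hfe : f = X ^ 4 + C (m.coeff 1 + g.coeff 1) * X ^ 3 +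
        C (m.coeff 0 + m.coeff 1 * g.coeff 1 + g.coeff 0) * X ^ 2 +
        C (m.coeff 0 * g.coeff 1 + m.coeff 1 * g.coeff 0) * X + C (m.coeff 0 * g.coeff 0) := by
      rw [hg]; simp only [C_add, C_mul]; ring
    have c0 := hfi 0 (by omega)
    have c1 := hfi 1 (by omega)
    have c2 := hfi 2 (by omega)
    have c3 := hfi 3 (by omega)
    simp only [hfe, coeff_add, coeff_C_mul, coeff_X_pow, coeff_X, coeff_C] at c0 c1 c2 c3
    norm_num at c0 c1 c2 c3
    refine quadratic_not_dvd_quartic hr0 (by simpa using hmr) hm0 ?_ c3 c2 c1 c0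
    rcases (show i = 0 ∨ i = 1 by omega) with rfl | rfl
    · exact Or.inr hipos
    · exact Or.inl hipos
  · have hme := eq_of_monic_natDegree_three hmm hd
    rw [eq_of_monic_natDegree_one hgm hd', hme] at hg
    rw [hme] at hmr
    have hfe : f = X ^ 4 + C (m.coeff 2 + g.coeff 0) * X ^ 3 +
        C (m.coeff 1 + m.coeff 2 * g.coeff 0) * X ^ 2 +
        C (m.coeff 0 + m.coeff 1 * g.coeff 0) * X + C (m.coeff 0 * g.coeff 0) := by
      rw [hg]; simp only [C_add, C_mul]; ring
    have c0 := hfi 0 (by omega)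
    have c1 := hfi 1 (by omega)
    have c2 := hfi 2 (by omega)
    have c3 := hfi 3 (by omega)
    simp only [hfe, coeff_add, coeff_C_mul, coeff_X_pow, coeff_X, coeff_C] at c0 c1 c2 c3
    norm_num at c0 c1 c2 c3
    obtain ⟨ha, hb, hc⟩ := cubic_signs hr0 (by simpa using hmr) hm0 (by
      rcases (show i = 0 ∨ i = 1 ∨ i = 2 by omega) with rfl | rfl | rfl
      · exact Or.inr (Or.inr hipos)
      · exact Or.inr (Or.inl hipos)
      · exact Or.inl hipos) c3 c2 c1 c0
    -- The relation is a constant multiple of the minimal polynomial, whose signs alternate, so it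
    -- has two negative coefficients.
    have htc : t = C (t.coeff 0) := eq_C_of_natDegree_eq_zero (by omega)
    have hs0 : t.coeff 0 ≠ 0 := fun h0 => ht0 (by rw [htc, h0, C_0])
    have hhc : ∀ i, h.coeff i = m.coeff i * t.coeff 0 := by
      intro i
      rw [ht, htc, coeff_mul_C]
      simp
    have h3 : m.coeff 3 = 1 := by rw [← hd]; exact hmm
    rcases lt_or_gt_of_ne hs0 with hs | hs
    · have hc3 : h.coeff 3 < 0 := by rw [hhc, h3, one_mul]; exact hs
      have hc1 : h.coeff 1 < 0 := by rw [hhc]; exact mul_neg_of_pos_of_neg hb hs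
      have e3 : 3 = j := by_contra fun hne => absurd (hh 3 hne) (not_le.2 hc3)
      have e1 : 1 = j := by_contra fun hne => absurd (hh 1 hne) (not_le.2 hc1)
      omega
    · have hc2 : h.coeff 2 < 0 := by rw [hhc]; exact mul_neg_of_neg_of_pos ha hs
      have hc0 : h.coeff 0 < 0 := by rw [hhc]; exact mul_neg_of_neg_of_pos hc hs
      have e2 : 2 = j := by_contra fun hne => absurd (hh 2 hne) (not_le.2 hc2)
      have e0 : 0 = j := by_contra fun hne => absurd (hh 0 hne) (not_le.2 hc0)
      omega

theorem atomSet_eq_image {α : ℂ} (hred : NoNatRelation α)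
    (hinj : Function.Injective fun k : ℕ => α ^ k) :
    atomSet (cyclicMonoid α) = powElem α '' {k | HasUniqueRep α k} := by
  ext z
  rw [mem_atomSet_iff hred hinj]
  rfl

theorem encard_image_powElem {α : ℂ} (hinj : Function.Injective fun k : ℕ => α ^ k) (S : Set ℕ) :
    (powElem α '' S).encard = S.encard :=
  Function.Injective.encard_image (fun _ _ h => hinj (congrArg Subtype.val h)) S

/-- The difference of two representations of `n α ^ j`, seen as a relation of `α` over `ℤ`. -/
theorem aeval_map_sub_monomial {α : ℂ} {p : ℕ[X]} {n j : ℕ} (h : aeval α p = n * α ^ j) :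
    aeval α (p.map (Nat.castRingHom ℤ) - monomial j (n : ℤ)) = 0 := by
  rw [map_sub, aeval_map_natCast, h, aeval_monomial]
  simp

theorem coeff_map_sub_monomial_nonneg (p : ℕ[X]) (n : ℕ) {i j : ℕ} (h : i ≠ j) :
    0 ≤ (p.map (Nat.castRingHom ℤ) - monomial j (n : ℤ)).coeff i := by
  simp [coeff_monomial, h.symm]

theorem degree_map_sub_monomial_lt {p : ℕ[X]} {N : ℕ} (hp : p.degree < N) (n : ℕ) {j : ℕ}
    (hj : j < N) : (p.map (Nat.castRingHom ℤ) - monomial j (n : ℤ)).degree < N :=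
  (degree_sub_le _ _).trans_lt (max_lt (degree_map_le.trans_lt hp)
    ((degree_monomial_le _ _).trans_lt (by exact_mod_cast hj)))

theorem eq_monomial_of_map_sub_eq_zero {p : ℕ[X]} {n j : ℕ}
    (h : p.map (Nat.castRingHom ℤ) - monomial j (n : ℤ) = 0) : p = monomial j n := by
  apply map_injective (Nat.castRingHom ℤ) Nat.cast_injective
  rw [sub_eq_zero.1 h, map_monomial]
  simp

/-- For `α = 0` and `α = 1` the monoid `M_α` is `ℕ₀`, whose only possible atom is `1`. -/
theorem atomSet_subset_of_eq_zero_or_one {α : ℂ} (h : α = 0 ∨ α = 1) :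
    atomSet (cyclicMonoid α) ⊆ {powElem α 0} := by
  intro z hz
  have hnat : ∃ n : ℕ, z = n • powElem α 0 := by
    obtain ⟨p, hp⟩ := mem_cyclicMonoid.1 z.2
    rcases h with rfl | rfl
    · refine ⟨p.coeff 0, Subtype.ext ?_⟩
      rw [← hp]
      simp [aeval_def, eval₂_at_zero]
    · refine ⟨p.eval 1, Subtype.ext ?_⟩
      rw [← hp]
      simp [aeval_def, eval₂_at_one]
  obtain ⟨n, rfl⟩ := hnat
  have hunit : ∀ k, IsAddUnit (k • powElem α 0) → k = 0 := by
    intro k hk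
    obtain ⟨w, hw⟩ := isAddUnit_iff_exists_neg.1 hk
    obtain ⟨q, hq⟩ := mem_cyclicMonoid.1 w.2
    obtain ⟨l, hl⟩ : ∃ l : ℕ, (w : ℂ) = l := by
      rw [← hq]
      rcases h with rfl | rfl
      · exact ⟨q.coeff 0, by simp [aeval_def, eval₂_at_zero]⟩
      · exact ⟨q.eval 1, by simp [aeval_def, eval₂_at_one]⟩
    have := congrArg Subtype.val hw
    simp [hl] at this
    have : k + l = 0 := by exact_mod_cast this
    omega
  have hn0 : n ≠ 0 := by
    rintro rfl
    exact hz.not_isAddUnit (by simp)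
  obtain ⟨k, rfl⟩ := Nat.exists_eq_succ_of_ne_zero hn0
  rcases hz.isAddUnit_or_isAddUnit (succ_nsmul (powElem α 0) k) with h | h
  · rw [hunit _ h]; simp
  · exact absurd (hunit 1 (by simpa using h)) one_ne_zero

theorem four_le_of_isRealizable {n : ℕ} (h : IsRealizable (n : ℕ∞) ((n + 1 : ℕ) : ℕ∞)) :
    4 ≤ n := by
  obtain ⟨α, hα, h⟩ := h
  by_contra! hn
  have hs : (strongAtomSet (cyclicMonoid α)).encard = n := congrArg Prod.fst h
  have ha : (atomSet (cyclicMonoid α)).encard = (n + 1 : ℕ) := congrArg Prod.snd h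
  have hn0 : n ≠ 0 := by
    rintro rfl
    obtain ⟨a, haa⟩ := Set.encard_eq_one.1 (by simpa using ha)
    rw [strongAtomSet_eq_of_atomSet_eq_singleton haa] at hs
    simp at hs
  have h01 : ¬ (α = 0 ∨ α = 1) := by
    intro h01
    have := Set.encard_le_encard (atomSet_subset_of_eq_zero_or_one h01)
    rw [ha, Set.encard_singleton] at this
    have : n + 1 ≤ 1 := by exact_mod_cast this
    omega
  push Not at h01
  have hred := noNatRelation_of_atomSet_nonempty h01.1
    (Set.encard_ne_zero.1 (by rw [ha]; exact_mod_cast n.succ_ne_zero))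
  obtain ⟨r, hr0, hr⟩ := hred.exists_pos_root hα
  have hr1 := ne_one_of_minpoly hα h01.2 hr
  have hinj := pow_injective_of_minpoly hr0 hr1 hr
  have hat := atomSet_eq_image hred hinj
  have hcard : {k | HasUniqueRep α k}.encard = (n + 1 : ℕ) := by
    rw [← encard_image_powElem hinj, ← hat, ha]
  have hE : {k | HasUniqueRep α k} = {k | k < n + 1} :=
    eq_setOf_lt_of_encard_eq (fun hk hjk => HasUniqueRep.of_le hk hjk) hcard
  have hE' : ∀ k, HasUniqueRep α k ↔ k < n + 1 := fun k => Set.ext_iff.1 hE k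
  obtain ⟨p, hpN, hp⟩ := exists_degree_lt_of_not_hasUniqueRep hred hr0 hr1 hr
    ((hE' 0).2 (by omega)) (mt (hE' (n + 1)).1 (by omega))
  rw [hE] at hat
  have hall : strongAtomSet (cyclicMonoid α) = atomSet (cyclicMonoid α) := by
    refine Set.Subset.antisymm (fun a h => h.1) ?_
    rw [hat]
    rintro _ ⟨j, hj, rfl⟩
    rw [powElem_mem_strongAtomSet_iff hinj hat hj]
    intro k _ q hq hqa
    exact eq_monomial_of_map_sub_eq_zero (eq_zero_of_coeff_nonneg h01.1 hr0 hr (by omega)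
      (fun i hi => (hE' i).2 hi) hpN hp (fun i hi => coeff_map_sub_monomial_nonneg q k hi)
      (degree_map_sub_monomial_lt hq k hj) (aeval_map_sub_monomial hqa))
  rw [hall, ha] at hs
  have : n + 1 = n := by exact_mod_cast hs
  omega

/-! ### A family with exactly one atom that is not strong -/

/-- The polynomial `x^(k+3) - 8 x^(k+2) + 12 x^(k+1) - 20 x^k - 2`. Its coefficients are chosen so
that it is Eisenstein at `2` for every `k`, also when the last two terms merge at `k = 0`, and
so that no integer, but a rational number (`3 / 2`, for instance), is a `w` for which the
nonleading coefficients of `(x + w) m(x)` are all nonpositive. -/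
noncomputable def familyPoly (k : ℕ) : ℤ[X] :=
  X ^ (k + 3) + C 2 * (C (-4) * X ^ (k + 2) + C 6 * X ^ (k + 1) + C (-10) * X ^ k + C (-1))

theorem familyPoly_degree_aux (k : ℕ) :
    (C 2 * (C (-4) * X ^ (k + 2) + C 6 * X ^ (k + 1) + C (-10) * X ^ k + C (-1)) : ℤ[X]).degree
      < (k + 3 : ℕ) := by
  rw [degree_lt_iff_coeff_zero]
  intro i hi
  have h2 : i ≠ k + 2 := by omega
  have h1 : i ≠ k + 1 := by omega
  have h0 : i ≠ k := by omega
  have h : i ≠ 0 := by omega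
  simp only [coeff_C_mul, coeff_add, coeff_X_pow, coeff_C, h2, h1, h0, h, if_false]
  norm_num

theorem familyPoly_monic (k : ℕ) : (familyPoly k).Monic :=
  monic_X_pow_add (familyPoly_degree_aux k)

theorem familyPoly_natDegree (k : ℕ) : (familyPoly k).natDegree = k + 3 := by
  apply natDegree_eq_of_degree_eq_some
  rw [familyPoly, degree_add_eq_left_of_degree_lt, degree_X_pow]
  rw [degree_X_pow]
  exact familyPoly_degree_aux k

theorem familyPoly_irreducible (k : ℕ) : Irreducible (familyPoly k) := by
  have hm := familyPoly_monic k
  refine irreducible_of_eisenstein_criterion (P := Ideal.span {2}) ?_ ?_ ?_ ?_ ?_ hm.isPrimitive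
  · rw [Ideal.span_singleton_prime two_ne_zero]
    exact Int.prime_two
  · rw [hm, Ideal.mem_span_singleton]
    norm_num
  · intro n hn
    rw [degree_eq_natDegree hm.ne_zero, familyPoly_natDegree, Nat.cast_lt] at hn
    rw [Ideal.mem_span_singleton, familyPoly, coeff_add, coeff_X_pow, if_neg hn.ne, zero_add,
      coeff_C_mul]
    exact dvd_mul_right _ _
  · rw [degree_eq_natDegree hm.ne_zero, familyPoly_natDegree]
    exact_mod_cast Nat.succ_pos _
  · rw [Ideal.span_singleton_pow, Ideal.mem_span_singleton]
    rcases k with _ | k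
    · simp [familyPoly, coeff_X_pow, coeff_one]
    · simp [familyPoly, coeff_X_pow, coeff_one]

theorem aeval_familyPoly {A : Type*} [CommRing A] (x : A) (k : ℕ) : aeval x (familyPoly k) =
    x ^ (k + 3) - 8 * x ^ (k + 2) + 12 * x ^ (k + 1) - 20 * x ^ k - 2 := by
  simp only [familyPoly, map_add, map_mul, map_pow, aeval_X, aeval_C]
  simp only [eq_intCast]
  push_cast
  ring

theorem familyPoly_exists_root (k : ℕ) : ∃ a : ℝ, 1 < a ∧ aeval a (familyPoly k) = 0 := by
  have hev : ∀ x : ℝ, aeval x (familyPoly k) =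
      x ^ k * (x ^ 3 - 8 * x ^ 2 + 12 * x - 20) - 2 := by
    intro x
    rw [aeval_familyPoly]
    ring
  have hcont : ContinuousOn (fun x : ℝ => aeval x (familyPoly k)) (Set.Icc 1 8) :=
    (familyPoly k).continuous_aeval.continuousOn
  have h1 : aeval (1 : ℝ) (familyPoly k) < 0 := by rw [hev]; norm_num
  have h8 : 0 ≤ aeval (8 : ℝ) (familyPoly k) := by
    rw [hev]
    have : (1 : ℝ) ≤ 8 ^ k := one_le_pow₀ (by norm_num)
    nlinarith
  obtain ⟨a, ha, ha0⟩ := intermediate_value_Icc (by norm_num : (1 : ℝ) ≤ 8) hcont ⟨h1.le, h8⟩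
  refine ⟨a, lt_of_le_of_ne ha.1 ?_, ha0⟩
  rintro rfl
  exact h1.ne ha0

theorem coeff_linear_mul_familyPoly (k : ℕ) (u v : ℤ) :
    let h := (C u * X + C v) * familyPoly k
    h.coeff (k + 4) = u ∧ h.coeff (k + 3) = v - 8 * u ∧ h.coeff (k + 2) = 12 * u - 8 * v ∧
      (h.coeff (k + 1) = 12 * v - 20 * u ∨ h.coeff (k + 1) = 12 * v - 22 * u) ∧
      (h.coeff 0 = -2 * v ∨ h.coeff 0 = -22 * v) := by
  intro h
  have e : h = C u * X ^ (k + 4) + C (v - 8 * u) * X ^ (k + 3) + C (12 * u - 8 * v) * X ^ (k + 2) +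
      C (12 * v - 20 * u) * X ^ (k + 1) + C (-20 * v) * X ^ k + C (-2 * u) * X + C (-2 * v) := by
    simp only [h, familyPoly, C_sub, C_mul, C_neg, pow_add]
    simp only [map_ofNat, map_one]
    ring
  rw [e]
  simp only [coeff_add, coeff_C_mul, coeff_X_pow, coeff_X, coeff_C]
  rcases k with _ | k
  · norm_num
    omega
  · simp

theorem exists_linear_of_aeval_eq_zero {k : ℕ} {α : ℂ} (hα : aeval α (familyPoly k) = 0)
    {h : ℤ[X]} (hh : h.degree < (k + 5 : ℕ)) (hhα : aeval α h = 0) :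
    ∃ u v : ℤ, h = (C u * X + C v) * familyPoly k := by
  have hint : IsIntegral ℤ α := ⟨_, familyPoly_monic k, hα⟩
  have h1 : familyPoly k ∣ minpoly ℤ α :=
    (minpoly.irreducible hint).dvd_symm (familyPoly_irreducible k)
      (minpoly.isIntegrallyClosed_dvd hint hα)
  obtain ⟨t, rfl⟩ := h1.trans (minpoly.isIntegrallyClosed_dvd hint hhα)
  rcases eq_or_ne t 0 with rfl | ht
  · exact ⟨0, 0, by simp⟩
  have hd := (natDegree_lt_iff_degree_lt
    (mul_ne_zero (familyPoly_monic k).ne_zero ht)).2 hh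
  rw [(familyPoly_monic k).natDegree_mul' ht, familyPoly_natDegree] at hd
  refine ⟨t.coeff 1, t.coeff 0, ?_⟩
  rw [mul_comm]
  congr 1
  exact eq_X_add_C_of_natDegree_le_one (by omega)

/-- For a root of `familyPoly k`, a relation of degree at most `k + 4` whose coefficients are
nonnegative, except possibly one below `x ^ (k + 4)`, is trivial. -/
theorem eq_zero_of_coeff_nonneg_of_familyPoly {k : ℕ} {α : ℂ} (hα : aeval α (familyPoly k) = 0)
    {h : ℤ[X]} (hh : h.degree < (k + 5 : ℕ)) (hhα : aeval α h = 0) {j : ℕ} (hj : j < k + 4)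
    (hpos : ∀ i, i ≠ j → 0 ≤ h.coeff i) : h = 0 := by
  obtain ⟨u, v, rfl⟩ := exists_linear_of_aeval_eq_zero hα hh hhα
  obtain ⟨c4, c3, c2, c1, c0⟩ := coeff_linear_mul_familyPoly k u v
  have p4 := hpos (k + 4) (by omega)
  have p3 := hpos (k + 3)
  have p2 := hpos (k + 2)
  have p1 := hpos (k + 1)
  have p0 := hpos 0
  have huv : u = 0 ∧ v = 0 := by
    generalize ((C u * X + C v) * familyPoly k).coeff (k + 4) = d4 at *
    generalize ((C u * X + C v) * familyPoly k).coeff (k + 3) = d3 at *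
    generalize ((C u * X + C v) * familyPoly k).coeff (k + 2) = d2 at *
    generalize ((C u * X + C v) * familyPoly k).coeff (k + 1) = d1 at *
    generalize ((C u * X + C v) * familyPoly k).coeff 0 = d0 at *
    omega
  simp [huv.1, huv.2]

theorem minpoly_ofReal (a : ℝ) : minpoly ℚ (a : ℂ) = minpoly ℚ a :=
  minpoly.algebraMap_eq (algebraMap ℝ ℂ).injective a

theorem noNatRelation_ofReal {a : ℝ} (ha : 0 < a) : NoNatRelation (a : ℂ) := by
  intro p hp
  have hpa : aeval a p = 0 :=
    aeval_eq_of_minpoly (α := a) (q := 0) (by rw [minpoly_ofReal, minpoly.aeval]) (by simpa using hp)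
      |>.trans (map_zero _)
  ext i
  by_contra hi
  have := pow_le_aeval ha.le hi
  rw [hpa] at this
  exact absurd (pow_pos ha i) (not_lt.2 this)

theorem hasUniqueRep_of_familyPoly {k : ℕ} {a : ℝ} (ha : 1 < a)
    (hα : aeval (a : ℂ) (familyPoly k) = 0) {j : ℕ} (hj : j < k + 5) :
    HasUniqueRep (a : ℂ) j := by
  intro p hp
  have hpa : aeval a p = a ^ j := by
    have := aeval_eq_of_minpoly (α := a) (r := a) (p := p) (q := X ^ j)
      (by rw [minpoly_ofReal, minpoly.aeval]) (by simpa using hp)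
    simpa using this
  by_cases hc : p.coeff j = 0
  · exfalso
    have hdeg := degree_lt_of_aeval_eq_pow ha hpa hc
    obtain ⟨h, hh⟩ : ∃ h, h = p.map (Nat.castRingHom ℤ) - monomial j ((1 : ℕ) : ℤ) := ⟨_, rfl⟩
    have hpos : ∀ i, i ≠ j → 0 ≤ h.coeff i := fun i hi =>
      hh ▸ coeff_map_sub_monomial_nonneg p 1 hi
    have hjc : h.coeff j = -1 := by rw [hh]; simp [hc]
    have hgt : ∀ i, j < i → h.coeff i = 0 := by
      intro i hi
      rw [hh]
      simp [coeff_monomial, hi.ne,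
        coeff_eq_zero_of_degree_lt (hdeg.trans (by exact_mod_cast hi))]
    have hdh : h.degree < (k + 5 : ℕ) := by
      rw [hh]
      exact degree_map_sub_monomial_lt (hdeg.trans (by exact_mod_cast hj)) 1 hj
    have hhα : aeval (a : ℂ) h = 0 := by
      rw [hh]
      exact aeval_map_sub_monomial (by simpa using hp)
    rcases Nat.lt_succ_iff_lt_or_eq.1 hj with hj | rfl
    · rw [eq_zero_of_coeff_nonneg_of_familyPoly hα hdh hhα hj hpos] at hjc
      simp at hjc
    · obtain ⟨u, v, rfl⟩ := exists_linear_of_aeval_eq_zero hα hdh hhα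
      obtain ⟨c4, c3, c2, c1, c0⟩ := coeff_linear_mul_familyPoly k u v
      have p3 := hpos (k + 3) (by omega)
      have p2 := hpos (k + 2) (by omega)
      have p1 := hpos (k + 1) (by omega)
      -- The linear cofactor is `-(x + w)`, and the signs confine the integer `w` to the interval
      -- from `3 / 2` to `11 / 6`.
      omega
  · obtain ⟨q, rfl⟩ := exists_eq_X_pow_add hc
    rw [map_add, map_pow, aeval_X, add_eq_left] at hp
    rw [noNatRelation_ofReal (zero_lt_one.trans ha) q hp, add_zero]

/-- The multiple `(x + 1)² m(x)` of `m = familyPoly k` has a single positive coefficient, the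
leading one. -/
theorem not_hasUniqueRep_of_familyPoly {k : ℕ} {α : ℂ} (hα : aeval α (familyPoly k) = 0) :
    ¬ HasUniqueRep α (k + 5) := by
  intro h
  have h1 := h (C 6 * X ^ (k + 4) + C 3 * X ^ (k + 3) + C 4 * X ^ (k + 2) + C 28 * X ^ (k + 1) +
    C 20 * X ^ k + C 2 * X ^ 2 + C 4 * X + C 2) (by
      rw [aeval_familyPoly] at hα
      simp only [map_add, map_mul, map_pow, aeval_X, aeval_C]
      simp only [eq_natCast, Nat.cast_ofNat]
      linear_combination (-(α + 1) ^ 2) * hα)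
  have h2 := congrArg (eval 1) h1
  simp at h2

/-- The multiple `(2 x + 3) m(x)` of `m = familyPoly k` has a single positive coefficient, the
leading one, which is `2`. -/
theorem not_strong_of_familyPoly {k : ℕ} {α : ℂ} (hα : aeval α (familyPoly k) = 0)
    (hinj : Function.Injective fun k : ℕ => α ^ k)
    (hat : atomSet (cyclicMonoid α) = powElem α '' {i | i < k + 5}) :
    powElem α (k + 4) ∉ strongAtomSet (cyclicMonoid α) := by
  rw [powElem_mem_strongAtomSet_iff hinj hat (by omega)]
  intro h
  have h1 := h 2 (by norm_num)
    (C 13 * X ^ (k + 3) + C 4 * X ^ (k + 1) + C 60 * X ^ k + C 4 * X + C 6) (by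
      rw [degree_lt_iff_coeff_zero]
      intro i hi
      have e3 : i ≠ k + 3 := by omega
      have e1 : i ≠ k + 1 := by omega
      have e0 : i ≠ k := by omega
      have e1' : 1 ≠ i := by omega
      have e0' : i ≠ 0 := by omega
      simp only [coeff_add, coeff_C_mul, coeff_X_pow, coeff_X, coeff_C, e3, e1, e0, e1', e0',
        if_false]
      norm_num)
    (by
      rw [aeval_familyPoly] at hα
      simp only [map_add, map_mul, map_pow, aeval_X, aeval_C]
      simp only [eq_natCast, Nat.cast_ofNat]
      linear_combination (-(2 * α + 3)) * hα)
  have h2 := congrArg (eval 1) h1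
  simp at h2

theorem isRealizable_add_four (k : ℕ) :
    IsRealizable ((k + 4 : ℕ) : ℕ∞) ((k + 4 + 1 : ℕ) : ℕ∞) := by
  obtain ⟨a, ha, hroot⟩ := familyPoly_exists_root k
  have hα : aeval (a : ℂ) (familyPoly k) = 0 := by
    have := aeval_algebraMap_apply ℂ a (familyPoly k)
    rw [hroot, map_zero] at this
    exact this
  have hred := noNatRelation_ofReal (zero_lt_one.trans ha)
  have hinj := pow_injective_of_minpoly (α := a) (zero_lt_one.trans ha) ha.ne'
    (by rw [minpoly_ofReal, minpoly.aeval])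
  have hcard : ∀ N : ℕ, ({i | i < N} : Set ℕ).encard = N := fun N => by
    rw [show {i | i < N} = (Finset.range N : Set ℕ) by ext; simp, Set.encard_coe_eq_coe_finsetCard,
      Finset.card_range]
  have hE : {i | HasUniqueRep (a : ℂ) i} = {i | i < k + 5} := by
    ext i
    refine ⟨fun hi => show i < k + 5 from not_le.1 fun hki => ?_,
      fun hi => hasUniqueRep_of_familyPoly ha hα hi⟩
    exact not_hasUniqueRep_of_familyPoly hα (HasUniqueRep.of_le hi hki)
  have hat := atomSet_eq_image hred hinj
  rw [hE] at hat
  have hst : strongAtomSet (cyclicMonoid (a : ℂ)) = powElem a '' {i | i < k + 4} := by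
    ext z
    constructor
    · intro hz
      have hz' := hz.1
      rw [hat] at hz'
      obtain ⟨j, hj, rfl⟩ := hz'
      refine ⟨j, lt_of_le_of_ne (Nat.lt_succ_iff.1 hj) ?_, rfl⟩
      rintro rfl
      exact not_strong_of_familyPoly hα hinj hat hz
    · rintro ⟨j, hj, rfl⟩
      have hj' : j < k + 5 := Nat.lt_succ_of_lt hj
      rw [powElem_mem_strongAtomSet_iff hinj hat hj']
      intro n _ q hq hqa
      exact eq_monomial_of_map_sub_eq_zero (eq_zero_of_coeff_nonneg_of_familyPoly hα
        (degree_map_sub_monomial_lt hq n hj') (aeval_map_sub_monomial hqa) hj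
        fun i hi => coeff_map_sub_monomial_nonneg q n hi)
  refine ⟨a, ?_, ?_⟩
  · exact (isAlgebraic_iff_isIntegral (K := ℚ)).2
      (show IsIntegral ℤ (a : ℂ) from ⟨_, familyPoly_monic k, hα⟩).tower_top
  · rw [realizationFunction, hst, hat, encard_image_powElem hinj, encard_image_powElem hinj, hcard,
      hcard]

theorem proposition4p3 (n : ℕ) :
    IsRealizable (n : ℕ∞) ((n + 1 : ℕ) : ℕ∞) ↔ 4 ≤ n := by
  refine ⟨four_le_of_isRealizable, fun h => ?_⟩
  obtain ⟨k, rfl⟩ := Nat.exists_eq_add_of_le' h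
  exact isRealizable_add_four k
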